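/- Let $\mathbb L^3$ be $\mathbb R^3$ with $\langle x,y\rangle=-x_1y_1+x_2y_2+x_3y_3$. A congruence of $\mathbb L^3$ is an affine map $x\mapsto Lx+c$ whose linear part $L$ preserves $\langle\cdot,\cdot\rangle$. A surface of revolution is a surface $X:I\times J\to\mathbb L^3$, with $I,J$ nonempty open intervals (for instance $J=\mathbb R$), which up to a congruence of $\mathbb L^3$ has one of the following forms, for real functions $a,b$ on $I$: (a) $X(t,s)=(a(t),\,b(t)\cos s,\,b(t)\sin s)$, (b) $X(t,s)=(a(t)\cosh s,\,a(t)\sinh s,\,b(t))$, (c) $X(t,s)=(a(t)\sinh s,\,a(t)\cosh s,\,b(t))$, (d) $X(t,s)=\Big(\frac{a(t)-b(t)}{\sqrt2}+\frac{a(t)s^2}{2\sqrt2},\ \frac{a(t)+b(t)}{\sqrt2}-\frac{a(t)s^2}{2\sqrt2},\ s\,a(t)\Big)$. It is timelike if the induced metric is nondegenerate of signature $(1,1)$ everywhere, and minimal if its mean curvature vanishes identically. **Theorem.** Let $X:I\times J\to\mathbb L^3$ be a real analytic, minimal, timelike surface of revolution that is not contained in an affine plane. Then $X$ is congruent to a part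 of one of the following surfaces; that is, some congruence carries $X(I\times J)$ onto the image of an open subset of the parameter domain of one of them: i) a Lorentzian elliptic catenoid $A\,(u+\theta,\ \cos u\cos v,\ \cos u\sin v)$, $u\in(-\pi/2,\pi/2)$, $v\in\mathbb R$, with $A>0$, $\theta\in\mathbb R$; ii) a Lorentzian hyperbolic catenoid $A\,(\sinh u\cosh v,\ \sinh u\sinh v,\ u-\theta)$, $u>0$, $v\in\mathbb R$, with $A>0$, $\theta\in\mathbb R$; iii) a Lorentzian surface with spacelike profile curve $A\,(\cosh v\sinh u,\ \cosh v\cosh u,\ v-\theta)$, $u,v\in\mathbb R$, with $A>0$, $\theta\in\mathbb R$; iv) a Lorentzian parabolic catenoid $A\big[\big(\tfrac{t^3}{6}+\tfrac B2t^2+\tfrac{B^2}{2}t+\tfrac{s^2}{2}(t+B)\big)L_1-(t+B)L_2+s(t+B)L_3\big]$, $t<-B$, $s\in\mathbb R$, with $A>0$, $B\in\mathbb R$, where $L_1=(-\tfrac{\sqrt2}2,\tfrac{\sqrt2}2,0)$, $L_2=(\tfrac{\sqrt2}2,\tfrac{\sqrt2}2,0)$, $L_3=(0,0,1)$. -/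

import Mathlib

open Set

noncomputable section

/-- The underlying space of Lorentz-Minkowski space (only its topology and
vector space structure are used; the metric is `lorentzInner`). -/
abbrev L3 : Type := Fin 3 → ℝ

/-- The Lorentzian inner product `-x₁y₁ + x₂y₂ + x₃y₃`. -/
def lorentzInner (x y : L3) : ℝ := -(x 0 * y 0) + x 1 * y 1 + x 2 * y 2

/-- The Lorentzian cross product, characterised by `⟨u × v, w⟩ = det [u, v, w]`. -/
def lorentzCross (u v : L3) : L3 :=
  ![-(u 1 * v 2 - u 2 * v 1), u 2 * v 0 - u 0 * v 2, u 0 * v 1 - u 1 * v 0]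

theorem lorentzInner_cross (u v w : L3) :
    lorentzInner (lorentzCross u v) w = Matrix.det (Matrix.of ![u, v, w]) := by
  simp [lorentzInner, lorentzCross, Matrix.det_fin_three]
  ring

/-- Congruences: affine maps whose linear part preserves the Lorentzian inner product. -/
def IsCongruence (Φ : L3 → L3) : Prop :=
  ∃ (L : L3 →ₗ[ℝ] L3) (c : L3),
    (∀ x y, lorentzInner (L x) (L y) = lorentzInner x y) ∧ ∀ x, Φ x = L x + c

/-! ### Parametrized surfaces -/

/-- Partial derivative in the first parameter. -/
def partial₁ (X : ℝ × ℝ → L3) (p : ℝ × ℝ) : L3 := deriv (fun t => X (t, p.2)) p.1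

/-- Partial derivative in the second parameter. -/
def partial₂ (X : ℝ × ℝ → L3) (p : ℝ × ℝ) : L3 := deriv (fun s => X (p.1, s)) p.2

/-- Coefficients of the first fundamental form. -/
def coeffE (X : ℝ × ℝ → L3) (p : ℝ × ℝ) : ℝ := lorentzInner (partial₁ X p) (partial₁ X p)

def coeffF (X : ℝ × ℝ → L3) (p : ℝ × ℝ) : ℝ := lorentzInner (partial₁ X p) (partial₂ X p)

def coeffG (X : ℝ × ℝ → L3) (p : ℝ × ℝ) : ℝ := lorentzInner (partial₂ X p) (partial₂ X p)

/-- The surface is timelike on `U`: the induced metric is nondegenerate of signature `(1,1)`,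
that is, its determinant is negative (in particular the map is an immersion there). -/
def IsTimelikeOn (X : ℝ × ℝ → L3) (U : Set (ℝ × ℝ)) : Prop :=
  ∀ p ∈ U, coeffE X p * coeffG X p - coeffF X p ^ 2 < 0

/-- The unit (spacelike) normal field of a timelike surface. -/
def unitNormal (X : ℝ × ℝ → L3) (p : ℝ × ℝ) : L3 :=
  (Real.sqrt (lorentzInner (lorentzCross (partial₁ X p) (partial₂ X p))
    (lorentzCross (partial₁ X p) (partial₂ X p))))⁻¹ •
    lorentzCross (partial₁ X p) (partial₂ X p)

/-- The mean curvature: half the trace of the second fundamental form with respect to the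
first. -/
def meanCurvature (X : ℝ × ℝ → L3) (p : ℝ × ℝ) : ℝ :=
  (coeffE X p * lorentzInner (partial₂ (partial₂ X) p) (unitNormal X p)
    - 2 * coeffF X p * lorentzInner (partial₁ (partial₂ X) p) (unitNormal X p)
    + coeffG X p * lorentzInner (partial₁ (partial₁ X) p) (unitNormal X p))
  / (2 * (coeffE X p * coeffG X p - coeffF X p ^ 2))

def IsMinimalOn (X : ℝ × ℝ → L3) (U : Set (ℝ × ℝ)) : Prop :=
  ∀ p ∈ U, meanCurvature X p = 0

/-- The surface lies in an affine plane. -/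
def IsPlanarOn (X : ℝ × ℝ → L3) (U : Set (ℝ × ℝ)) : Prop :=
  ∃ (n : L3) (c : ℝ), n ≠ 0 ∧ ∀ p ∈ U, lorentzInner n (X p) = c

/-! ### Surfaces of revolution

The profile curve is `(a, b)`, with parameter `t`; the rotation parameter is `s`. The conditions
on the profile curve that make such a surface timelike are left to `IsTimelikeOn`, to which they
are equivalent. -/

/-- Timelike axis. -/
def revElliptic (a b : ℝ → ℝ) (p : ℝ × ℝ) : L3 :=
  ![a p.1, b p.1 * Real.cos p.2, b p.1 * Real.sin p.2]

/-- Spacelike axis, profile curve in a timelike plane. -/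
def revHyperbolic (a b : ℝ → ℝ) (p : ℝ × ℝ) : L3 :=
  ![a p.1 * Real.cosh p.2, a p.1 * Real.sinh p.2, b p.1]

/-- Spacelike axis, profile curve in a spacelike plane. -/
def revSpacelikeProfile (a b : ℝ → ℝ) (p : ℝ × ℝ) : L3 :=
  ![a p.1 * Real.sinh p.2, a p.1 * Real.cosh p.2, b p.1]

/-- Lightlike axis. -/
def revParabolic (a b : ℝ → ℝ) (p : ℝ × ℝ) : L3 :=
  ![(a p.1 - b p.1) / √2 + a p.1 * p.2 ^ 2 / (2 * √2),
    (a p.1 + b p.1) / √2 - a p.1 * p.2 ^ 2 / (2 * √2),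
    p.2 * a p.1]

/-- `X`, on the product of the nonempty open intervals `I` (profile) and `J` (rotation), is a
surface of revolution: up to a congruence it is of one of the four types. -/
def IsSurfaceOfRevolution (X : ℝ × ℝ → L3) (I J : Set ℝ) : Prop :=
  (IsOpen I ∧ IsConnected I) ∧ (IsOpen J ∧ IsConnected J) ∧
  ∃ (a b : ℝ → ℝ) (Φ : L3 → L3), IsCongruence Φ ∧
    ((∀ p ∈ I ×ˢ J, X p = Φ (revElliptic a b p)) ∨
     (∀ p ∈ I ×ˢ J, X p = Φ (revHyperbolic a b p)) ∨
     (∀ p ∈ I ×ˢ J, X p = Φ (revSpacelikeProfile a b p)) ∨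
     (∀ p ∈ I ×ˢ J, X p = Φ (revParabolic a b p)))

/-! ### The model surfaces and their parameter domains -/

def ellipticCatenoid (A θ : ℝ) (p : ℝ × ℝ) : L3 :=
  A • ![p.1 + θ, Real.cos p.1 * Real.cos p.2, Real.cos p.1 * Real.sin p.2]

def ellipticCatenoidDomain : Set (ℝ × ℝ) := Ioo (-(Real.pi / 2)) (Real.pi / 2) ×ˢ univ

def hyperbolicCatenoid (A θ : ℝ) (p : ℝ × ℝ) : L3 :=
  A • ![Real.sinh p.1 * Real.cosh p.2, Real.sinh p.1 * Real.sinh p.2, p.1 - θ]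

def hyperbolicCatenoidDomain : Set (ℝ × ℝ) := Ioi 0 ×ˢ univ

/-- The Lorentzian surface with spacelike profile curve, in parameters `(u, v) ∈ ℝ²`
(`v` is the profile parameter). -/
def spacelikeProfileSurface (A θ : ℝ) (p : ℝ × ℝ) : L3 :=
  A • ![Real.cosh p.2 * Real.sinh p.1, Real.cosh p.2 * Real.cosh p.1, p.2 - θ]

/-- The vector with coordinates `(x, y, z)` in the null frame
`L₁ = (-√2/2, √2/2, 0)`, `L₂ = (√2/2, √2/2, 0)`, `L₃ = (0, 0, 1)`. -/
def nullFrame (x y z : ℝ) : L3 :=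
  x • ![-(√2 / 2), √2 / 2, 0] + y • ![√2 / 2, √2 / 2, 0] + z • ![0, 0, 1]

def parabolicCatenoid (A B : ℝ) (p : ℝ × ℝ) : L3 :=
  A • nullFrame
    (p.1 ^ 3 / 6 + B / 2 * p.1 ^ 2 + B ^ 2 / 2 * p.1 + p.2 ^ 2 / 2 * (p.1 + B))
    (-(p.1 + B)) (p.2 * (p.1 + B))

def parabolicCatenoidDomain (B : ℝ) : Set (ℝ × ℝ) := Iio (-B) ×ˢ univ

/-- The set `S` is congruent to a part of the surface parametrized by `Y` on `D`: a congruence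
carries `S` onto the image of an open subset of `D`. -/
def CongruentToPart (S : Set L3) (Y : ℝ × ℝ → L3) (D : Set (ℝ × ℝ)) : Prop :=
  ∃ Φ : L3 → L3, IsCongruence Φ ∧ ∃ V ⊆ D, IsOpen V ∧ Φ '' S = Y '' V

end

/-! Timelikeness and vanishing mean curvature survive congruences, so each of the four normal forms
can be treated directly. By rotational symmetry, minimality is then an ordinary differential
equation for the profile curve, readable along one profile curve `s = const`.

For a non-lightlike axis let `x` be the radius and `y` the height. The induced metric on the profile
is `±(κ y'² - x'²)` with `κ = ±1`. Translation along the axis yields a conserved flux, whose square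
is `x² y'² / (κ y'² - x'²)` (`profile_first_integral`). Calling it `±A²` and putting `p = x/A`, `q =
x'/y'`, `u = y/A + const`, the equation becomes linear: `dp/du = q` and `dq/du = ∓p`, with `q² = κ ∓
p²`. The sign `-` occurs for a timelike axis and gives `p = cos u`. The sign `+` occurs for a
spacelike axis and gives, up to signs, `p = sinh u` if `κ = 1` and `p = cosh u` if `κ = -1`. The
degenerate value `y' ≡ 0`, possible only over a spacelike axis, is a plane.

For a lightlike axis the conserved quantity is `b'/(a' a²)`, so `b` is a cubic in `a`
(`parabolic_profile`).

Finally `u` has nonvanishing derivative, hence open image, and serves as the profile parameter of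
the model (`congruentToPart_of_prod`). -/

/-! ### Congruences and their inverses -/

theorem lorentzInner_nondegenerate {x : L3} (h : ∀ y, lorentzInner x y = 0) : x = 0 := by
  have h0 := h ![1, 0, 0]
  have h1 := h ![0, 1, 0]
  have h2 := h ![0, 0, 1]
  simp [lorentzInner] at h0 h1 h2
  ext i
  fin_cases i <;> simp [h0, h1, h2]

theorem lorentzInner_add_right (x y z : L3) :
    lorentzInner x (y + z) = lorentzInner x y + lorentzInner x z := by
  simp [lorentzInner]; ring

/-- A congruence is the composition of a linear isometric automorphism and a translation. -/
theorem IsCongruence.exists_equiv {Φ : L3 → L3} (h : IsCongruence Φ) :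
    ∃ (e : L3 ≃L[ℝ] L3) (c : L3),
      (∀ x y, lorentzInner (e x) (e y) = lorentzInner x y) ∧ ∀ x, Φ x = e x + c := by
  obtain ⟨L, c, hL, hΦ⟩ := h
  have hinj : Function.Injective L := by
    rw [← LinearMap.ker_eq_bot, LinearMap.ker_eq_bot']
    intro x hx
    refine lorentzInner_nondegenerate fun y => ?_
    rw [← hL, hx]
    simp [lorentzInner]
  exact ⟨(LinearEquiv.ofInjectiveEndo L hinj).toContinuousLinearEquiv, c, hL, hΦ⟩

theorem IsCongruence.comp {Φ Ψ : L3 → L3} (hΦ : IsCongruence Φ) (hΨ : IsCongruence Ψ) :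
    IsCongruence (Φ ∘ Ψ) := by
  obtain ⟨L, c, hL, hΦ⟩ := hΦ
  obtain ⟨M, d, hM, hΨ⟩ := hΨ
  refine ⟨L ∘ₗ M, L d + c, fun x y => ?_, fun x => ?_⟩
  · simp [hL, hM]
  · simp [hΦ, hΨ, add_assoc]

theorem isCongruence_symm {e : L3 ≃L[ℝ] L3} (c : L3)
    (he : ∀ x y, lorentzInner (e x) (e y) = lorentzInner x y) :
    IsCongruence fun x => e.symm (x - c) := by
  refine ⟨e.symm.toLinearEquiv.toLinearMap, -e.symm c, fun x y => ?_, fun x => ?_⟩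
  · rw [← he]; simp
  · simp [sub_eq_add_neg]

theorem CongruentToPart.of_image {S : Set L3} {Y : ℝ × ℝ → L3} {D : Set (ℝ × ℝ)}
    {Φ : L3 → L3} (hΦ : IsCongruence Φ) (h : CongruentToPart (Φ '' S) Y D) :
    CongruentToPart S Y D := by
  obtain ⟨Ψ, hΨ, V, hV, hVo, he⟩ := h
  exact ⟨Ψ ∘ Φ, hΨ.comp hΦ, V, hV, hVo, by rw [image_comp, he]⟩

/-- The factor is `det e`. Only its being nonzero matters: it drops out of the equation of
minimality. -/
theorem lorentzDet_map (e : L3 ≃L[ℝ] L3) :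
    ∃ δ : ℝ, δ ≠ 0 ∧ ∀ u v w : L3,
      (Matrix.of ![e u, e v, e w]).det = δ * (Matrix.of ![u, v, w]).det := by
  refine ⟨LinearMap.det (e.toLinearEquiv : L3 →ₗ[ℝ] L3),
    (LinearEquiv.isUnit_det' e.toLinearEquiv).ne_zero, fun u v w => ?_⟩
  have h := (Pi.basisFun ℝ (Fin 3)).det_comp (e.toLinearEquiv : L3 →ₗ[ℝ] L3) ![u, v, w]
  rw [Pi.basisFun_det_apply, Pi.basisFun_det_apply] at h
  rw [← h]
  congr 1
  ext i j
  fin_cases i <;> rfl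

/-! ### Partial derivatives and congruences -/

theorem partial₁_eqOn {X Y : ℝ × ℝ → L3} {U : Set (ℝ × ℝ)} (hU : IsOpen U) (h : EqOn X Y U) :
    EqOn (partial₁ X) (partial₁ Y) U := by
  intro p hp
  refine Filter.EventuallyEq.deriv_eq ?_
  have hc : ContinuousAt (fun t : ℝ => (t, p.2)) p.1 := by fun_prop
  filter_upwards [hc (hU.mem_nhds hp)] with t ht using h ht

theorem partial₂_eqOn {X Y : ℝ × ℝ → L3} {U : Set (ℝ × ℝ)} (hU : IsOpen U) (h : EqOn X Y U) :
    EqOn (partial₂ X) (partial₂ Y) U := by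
  intro p hp
  refine Filter.EventuallyEq.deriv_eq ?_
  have hc : ContinuousAt (fun s : ℝ => (p.1, s)) p.2 := by fun_prop
  filter_upwards [hc (hU.mem_nhds hp)] with t ht using h ht

/-- No differentiability is needed: composing with an invertible `e` neither creates nor destroys
it, and otherwise both sides are zero. -/
theorem deriv_equiv_comp (e : L3 ≃L[ℝ] L3) (f : ℝ → L3) (t : ℝ) :
    deriv (fun t => e (f t)) t = e (deriv f t) := by
  have h := e.comp_fderiv (f := f) (x := t)
  exact congrArg (fun g => g 1) h

theorem partial₁_equiv (e : L3 ≃L[ℝ] L3) (Y : ℝ × ℝ → L3) :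
    partial₁ (fun p => e (Y p)) = fun p => e (partial₁ Y p) :=
  funext fun _ => deriv_equiv_comp e _ _

theorem partial₂_equiv (e : L3 ≃L[ℝ] L3) (Y : ℝ × ℝ → L3) :
    partial₂ (fun p => e (Y p)) = fun p => e (partial₂ Y p) :=
  funext fun _ => deriv_equiv_comp e _ _

theorem partial₁_affine (e : L3 ≃L[ℝ] L3) (c : L3) (Y : ℝ × ℝ → L3) :
    partial₁ (fun p => e (Y p) + c) = fun p => e (partial₁ Y p) := by
  rw [← partial₁_equiv]
  exact funext fun p => by simp [partial₁]

theorem partial₂_affine (e : L3 ≃L[ℝ] L3) (c : L3) (Y : ℝ × ℝ → L3) :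
    partial₂ (fun p => e (Y p) + c) = fun p => e (partial₂ Y p) := by
  rw [← partial₂_equiv]
  exact funext fun p => by simp [partial₂]

/-- The numerator of the mean curvature, with the normal field left unnormalised. -/
noncomputable def minimalNumerator (X : ℝ × ℝ → L3) (p : ℝ × ℝ) : ℝ :=
  coeffE X p * (Matrix.of ![partial₁ X p, partial₂ X p, partial₂ (partial₂ X) p]).det
    - 2 * coeffF X p * (Matrix.of ![partial₁ X p, partial₂ X p, partial₁ (partial₂ X) p]).det
    + coeffG X p * (Matrix.of ![partial₁ X p, partial₂ X p, partial₁ (partial₁ X) p]).det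

theorem lorentzInner_cross_self (u v : L3) :
    lorentzInner (lorentzCross u v) (lorentzCross u v) =
      lorentzInner u v ^ 2 - lorentzInner u u * lorentzInner v v := by
  simp [lorentzInner, lorentzCross]; ring

theorem lorentzInner_smul_cross (k : ℝ) (u v w : L3) :
    lorentzInner w (k • lorentzCross u v) = k * (Matrix.of ![u, v, w]).det := by
  rw [← lorentzInner_cross]
  simp [lorentzInner]; ring

/-- Timelikeness makes the cross product of the partial derivatives spacelike and nonzero, so the
normalising factor of the normal is positive and can be cancelled; the square root thereby
disappears. -/
theorem minimalNumerator_eq_zero {X : ℝ × ℝ → L3} {U : Set (ℝ × ℝ)} (ht : IsTimelikeOn X U)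
    (hm : IsMinimalOn X U) : ∀ p ∈ U, minimalNumerator X p = 0 := by
  intro p hp
  have h1 := ht p hp
  have h2 := hm p hp
  have hpos : 0 < lorentzInner (lorentzCross (partial₁ X p) (partial₂ X p))
      (lorentzCross (partial₁ X p) (partial₂ X p)) := by
    rw [lorentzInner_cross_self]
    simp only [coeffE, coeffF, coeffG] at h1
    linarith
  have hk := (inv_pos.2 (Real.sqrt_pos.2 hpos)).ne'
  unfold meanCurvature at h2
  rw [div_eq_zero_iff, or_iff_left (by intro h; linarith)] at h2
  simp only [unitNormal, lorentzInner_smul_cross] at h2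
  refine (mul_eq_zero.1 (Eq.trans ?_ h2)).resolve_left hk
  unfold minimalNumerator
  ring

/-! ### Invariance of the hypotheses and the conclusion under congruences -/

section Transfer

variable {X Y : ℝ × ℝ → L3} {U : Set (ℝ × ℝ)} {e : L3 ≃L[ℝ] L3} {c : L3}

theorem isTimelikeOn_of_congruent (hU : IsOpen U)
    (he : ∀ x y, lorentzInner (e x) (e y) = lorentzInner x y)
    (hXY : EqOn X (fun p => e (Y p) + c) U) (h : IsTimelikeOn X U) : IsTimelikeOn Y U := by
  intro p hp
  have := h p hp
  simp only [coeffE, coeffF, coeffG, partial₁_eqOn hU hXY hp, partial₂_eqOn hU hXY hp,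
    partial₁_affine, partial₂_affine, he] at this
  exact this

theorem minimalNumerator_eq_zero_of_congruent (hU : IsOpen U)
    (he : ∀ x y, lorentzInner (e x) (e y) = lorentzInner x y)
    (hXY : EqOn X (fun p => e (Y p) + c) U) (h : ∀ p ∈ U, minimalNumerator X p = 0) :
    ∀ p ∈ U, minimalNumerator Y p = 0 := by
  intro p hp
  obtain ⟨δ, hδ, hdet⟩ := lorentzDet_map e
  have h1 := partial₁_eqOn hU hXY
  have h2 := partial₂_eqOn hU hXY
  rw [partial₁_affine] at h1
  rw [partial₂_affine] at h2
  have h11 := partial₁_eqOn hU h1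
  have h12 := partial₁_eqOn hU h2
  have h22 := partial₂_eqOn hU h2
  rw [partial₁_equiv] at h11 h12
  rw [partial₂_equiv] at h22
  have h0 := h p hp
  simp only [minimalNumerator, coeffE, coeffF, coeffG, h1 hp, h2 hp, h11 hp, h12 hp, h22 hp, he,
    hdet] at h0
  refine (mul_eq_zero.1 (Eq.trans ?_ h0)).resolve_left hδ
  simp only [minimalNumerator, coeffE, coeffF, coeffG]
  ring

theorem isPlanarOn_of_congruent (he : ∀ x y, lorentzInner (e x) (e y) = lorentzInner x y)
    (hXY : EqOn X (fun p => e (Y p) + c) U) (h : IsPlanarOn Y U) : IsPlanarOn X U := by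
  obtain ⟨n, k, hn, hk⟩ := h
  refine ⟨e n, k + lorentzInner (e n) c, by simpa using hn, fun p hp => ?_⟩
  rw [hXY hp, lorentzInner_add_right, he, hk p hp]

theorem analyticOnNhd_of_congruent (hU : IsOpen U) (hXY : EqOn X (fun p => e (Y p) + c) U)
    (h : AnalyticOnNhd ℝ X U) : AnalyticOnNhd ℝ Y U := by
  have h' : AnalyticOnNhd ℝ (fun p => e.symm (X p - c)) U :=
    (e.symm : L3 →L[ℝ] L3).comp_analyticOnNhd (h.sub analyticOnNhd_const)
  refine h'.congr hU fun p hp => ?_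
  simp [hXY hp]

theorem congruentToPart_of_congruent (he : ∀ x y, lorentzInner (e x) (e y) = lorentzInner x y)
    (hXY : EqOn X (fun p => e (Y p) + c) U) {Z : ℝ × ℝ → L3} {D : Set (ℝ × ℝ)}
    (h : CongruentToPart (Y '' U) Z D) : CongruentToPart (X '' U) Z D := by
  refine CongruentToPart.of_image (isCongruence_symm c he) ?_
  rw [image_image]
  rwa [image_congr (g := Y) fun p hp => by simp [hXY hp]]

end Transfer

/-! ### Derivatives and open images of analytic functions -/

theorem AnalyticOnNhd.hasDerivAt_deriv {f : ℝ → ℝ} {I : Set ℝ} (hf : AnalyticOnNhd ℝ f I) :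
    (∀ t ∈ I, HasDerivAt f (deriv f t) t) ∧
      ∀ t ∈ I, HasDerivAt (deriv f) (deriv (deriv f) t) t :=
  ⟨fun t ht => (hf t ht).differentiableAt.hasDerivAt,
    fun t ht => (hf.deriv t ht).differentiableAt.hasDerivAt⟩

theorem AnalyticOnNhd.isOpen_image_of_deriv_ne_zero {f : ℝ → ℝ} {I : Set ℝ} (hI : IsOpen I)
    (hf : AnalyticOnNhd ℝ f I) (h : ∀ t ∈ I, deriv f t ≠ 0) : IsOpen (f '' I) := by
  rw [isOpen_iff_mem_nhds]
  rintro _ ⟨t, ht, rfl⟩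
  rw [← (hf t ht).hasStrictDerivAt.map_nhds_eq (h t ht)]
  exact Filter.image_mem_map (hI.mem_nhds ht)

/-! ### The differential equations of the profile curves -/

section ODE

variable {I : Set ℝ}

theorem IsOpen.eq_of_hasDerivAt_zero (hI : IsOpen I) (hc : IsPreconnected I) {f : ℝ → ℝ}
    (hf : ∀ t ∈ I, HasDerivAt f 0 t) {s t : ℝ} (hs : s ∈ I) (ht : t ∈ I) : f s = f t :=
  hI.is_const_of_deriv_eq_zero hc (fun t ht => (hf t ht).differentiableAt.differentiableWithinAt)
    (fun t ht => (hf t ht).deriv) hs ht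

theorem IsPreconnected.pos_of_ne_zero (hc : IsPreconnected I) {f : ℝ → ℝ} (hf : ContinuousOn f I)
    (h0 : ∀ t ∈ I, f t ≠ 0) {t₀ : ℝ} (ht₀ : t₀ ∈ I) (hpos : 0 < f t₀) : ∀ t ∈ I, 0 < f t := by
  intro t ht
  by_contra hn
  obtain ⟨r, hr, hr0⟩ := hc.intermediate_value ht ht₀ hf ⟨not_lt.1 hn, hpos.le⟩
  exact h0 r hr hr0

variable {x y x₁ y₁ x₂ y₂ : ℝ → ℝ}

/-- The first integral of the profile curve equation of a minimal surface of revolution, with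
radius `x` and height `y`. -/
theorem profile_first_integral (hI : IsOpen I) (hc : IsPreconnected I) (κ : ℝ)
    (hx : ∀ t ∈ I, HasDerivAt x (x₁ t) t) (hx₁ : ∀ t ∈ I, HasDerivAt x₁ (x₂ t) t)
    (hy₁ : ∀ t ∈ I, HasDerivAt y₁ (y₂ t) t)
    (hD : ∀ t ∈ I, κ * y₁ t ^ 2 - x₁ t ^ 2 ≠ 0)
    (hode : ∀ t ∈ I, y₁ t * (κ * y₁ t ^ 2 - x₁ t ^ 2) + x t * (y₁ t * x₂ t - x₁ t * y₂ t) = 0)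
    {t₀ : ℝ} (ht₀ : t₀ ∈ I) :
    ∀ t ∈ I, x t ^ 2 * y₁ t ^ 2 =
      x t₀ ^ 2 * y₁ t₀ ^ 2 / (κ * y₁ t₀ ^ 2 - x₁ t₀ ^ 2) * (κ * y₁ t ^ 2 - x₁ t ^ 2) := by
  intro t ht
  -- The quotient is the squared flux of the area functional `∫ x √|κ y'² - x'²|` under translations
  -- of `y`. The numerator of its derivative is `2 x y' x'` times the equation.
  rw [← div_eq_iff (hD t ht)]
  refine hI.eq_of_hasDerivAt_zero hc (f := fun t => x t ^ 2 * y₁ t ^ 2 / (κ * y₁ t ^ 2 - x₁ t ^ 2))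
    (fun t ht => ?_) ht ht₀
  have h := (((hx t ht).pow 2).mul ((hy₁ t ht).pow 2)).div
    ((((hy₁ t ht).pow 2).const_mul κ).sub ((hx₁ t ht).pow 2)) (hD t ht)
  refine h.congr_deriv ?_
  rw [div_eq_zero_iff]
  left
  simp only [Pi.mul_apply, Pi.pow_apply, Pi.sub_apply]
  push_cast
  linear_combination 2 * x t * y₁ t * x₁ t * hode t ht

/-- With `D = κ y'² - x'²`, the equation gives `(x'/y')' = -D/(x y')`, and the first integral
replaces `D` by `x² y'²/N`. The result is linear in `x`. -/
theorem profile_slope_hasDerivAt {N t : ℝ} (κ : ℝ) (hx₁ : HasDerivAt x₁ (x₂ t) t)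
    (hy₁ : HasDerivAt y₁ (y₂ t) t) (hN : N ≠ 0) (hx0 : x t ≠ 0) (hy0 : y₁ t ≠ 0)
    (hode : y₁ t * (κ * y₁ t ^ 2 - x₁ t ^ 2) + x t * (y₁ t * x₂ t - x₁ t * y₂ t) = 0)
    (hint : x t ^ 2 * y₁ t ^ 2 = N * (κ * y₁ t ^ 2 - x₁ t ^ 2)) :
    HasDerivAt (fun t => x₁ t / y₁ t) (-(x t * y₁ t / N)) t := by
  refine (hx₁.div hy₁ hy0).congr_deriv ?_
  field_simp
  refine mul_left_cancel₀ hx0 ?_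
  linear_combination N * hode + y₁ t * hint

/-- The system is an infinitesimal rotation, so the distance between the two solutions `(p, q)` and
`(cos u, -sin u)` is constant. -/
theorem trigonometric_system (hI : IsOpen I) (hc : IsPreconnected I) {p q u ω : ℝ → ℝ}
    (hu : ∀ t ∈ I, HasDerivAt u (ω t) t) (hp : ∀ t ∈ I, HasDerivAt p (ω t * q t) t)
    (hq : ∀ t ∈ I, HasDerivAt q (-(ω t * p t)) t) {t₀ : ℝ} (ht₀ : t₀ ∈ I)
    (hp₀ : p t₀ = Real.cos (u t₀)) (hq₀ : q t₀ = -Real.sin (u t₀)) :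
    ∀ t ∈ I, p t = Real.cos (u t) := by
  intro t ht
  have key := hI.eq_of_hasDerivAt_zero hc
    (f := fun t => (p t - Real.cos (u t)) ^ 2 + (q t + Real.sin (u t)) ^ 2) (fun t ht => by
      refine ((((hp t ht).sub (hu t ht).cos).pow 2).add
        (((hq t ht).add (hu t ht).sin).pow 2)).congr_deriv ?_
      simp only [Pi.sub_apply, Pi.add_apply]
      push_cast
      ring) ht ht₀
  simp only [hp₀, hq₀] at key
  nlinarith [sq_nonneg (p t - Real.cos (u t)), sq_nonneg (q t + Real.sin (u t))]

/-- The combinations `q + p` and `q - p` diagonalise the system and are multiples of `exp u` and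
`exp (-u)`. -/
theorem hyperbolic_system (hI : IsOpen I) (hc : IsPreconnected I) {p q u ω : ℝ → ℝ}
    (hu : ∀ t ∈ I, HasDerivAt u (ω t) t) (hp : ∀ t ∈ I, HasDerivAt p (ω t * q t) t)
    (hq : ∀ t ∈ I, HasDerivAt q (ω t * p t) t) {t₀ : ℝ} (ht₀ : t₀ ∈ I)
    (hp₀ : p t₀ = Real.sinh (u t₀)) (hq₀ : q t₀ = Real.cosh (u t₀)) :
    ∀ t ∈ I, p t = Real.sinh (u t) ∧ q t = Real.cosh (u t) := by
  intro t ht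
  have k₁ := hI.eq_of_hasDerivAt_zero hc
    (f := fun t => (p t + q t - Real.exp (u t)) * Real.exp (-u t)) (fun t ht => by
      refine ((((hp t ht).add (hq t ht)).sub (hu t ht).exp).mul (hu t ht).neg.exp).congr_deriv ?_
      simp only [Pi.sub_apply, Pi.add_apply, Pi.neg_apply]
      ring) ht ht₀
  have k₂ := hI.eq_of_hasDerivAt_zero hc
    (f := fun t => (q t - p t - Real.exp (-u t)) * Real.exp (u t)) (fun t ht => by
      refine ((((hq t ht).sub (hp t ht)).sub (hu t ht).neg.exp).mul (hu t ht).exp).congr_deriv ?_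
      simp only [Pi.sub_apply, Pi.neg_apply]
      ring) ht ht₀
  simp only [hp₀, hq₀, Real.sinh_add_cosh, Real.cosh_sub_sinh, sub_self, zero_mul, mul_eq_zero,
    Real.exp_ne_zero, or_false] at k₁ k₂
  rw [Real.sinh_eq, Real.cosh_eq]
  constructor <;> linarith

/-- Profile curves with positive radius over a timelike axis. -/
theorem elliptic_profile (hI : IsOpen I) (hc : IsConnected I)
    (hx : ∀ t ∈ I, HasDerivAt x (x₁ t) t) (hx₁ : ∀ t ∈ I, HasDerivAt x₁ (x₂ t) t)
    (hy : ∀ t ∈ I, HasDerivAt y (y₁ t) t) (hy₁ : ∀ t ∈ I, HasDerivAt y₁ (y₂ t) t)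
    (hx0 : ∀ t ∈ I, 0 < x t) (hD : ∀ t ∈ I, x₁ t ^ 2 < y₁ t ^ 2)
    (hode : ∀ t ∈ I, y₁ t * (y₁ t ^ 2 - x₁ t ^ 2) + x t * (y₁ t * x₂ t - x₁ t * y₂ t) = 0) :
    ∃ A θ : ℝ, 0 < A ∧ ∀ t ∈ I, y t / A - θ ∈ Ioo (-(Real.pi / 2)) (Real.pi / 2) ∧
      x t = A * Real.cos (y t / A - θ) := by
  obtain ⟨t₀, ht₀⟩ := hc.nonempty
  have hc := hc.isPreconnected
  have hy0 : ∀ t ∈ I, y₁ t ≠ 0 := fun t ht h => by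
    have := hD t ht
    rw [h] at this
    nlinarith [sq_nonneg (x₁ t)]
  have hint := profile_first_integral hI hc 1 hx hx₁ hy₁
    (fun t ht => by have := hD t ht; intro h; linarith) (fun t ht => by simpa using hode t ht) ht₀
  have hN : 0 < x t₀ ^ 2 * y₁ t₀ ^ 2 / (1 * y₁ t₀ ^ 2 - x₁ t₀ ^ 2) := by
    have h1 := hx0 t₀ ht₀
    have h2 := hy0 t₀ ht₀
    have := hD t₀ ht₀
    have h3 : 0 < 1 * y₁ t₀ ^ 2 - x₁ t₀ ^ 2 := by linarith
    positivity
  obtain ⟨A, hA, hAN⟩ : ∃ A : ℝ, 0 < A ∧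
      A ^ 2 = x t₀ ^ 2 * y₁ t₀ ^ 2 / (1 * y₁ t₀ ^ 2 - x₁ t₀ ^ 2) :=
    ⟨_, Real.sqrt_pos.2 hN, Real.sq_sqrt hN.le⟩
  rw [← hAN] at hint
  have hq := fun t ht => profile_slope_hasDerivAt 1 (hx₁ t ht) (hy₁ t ht) (pow_pos hA 2).ne'
    (hx0 t ht).ne' (hy0 t ht) (by simpa using hode t ht) (hint t ht)
  have hunit : (x t₀ / A) ^ 2 + (x₁ t₀ / y₁ t₀) ^ 2 = 1 := by
    have := hy0 t₀ ht₀
    field_simp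
    linear_combination hint t₀ ht₀
  have hcos : 0 < x t₀ / A := div_pos (hx0 t₀ ht₀) hA
  have hlt : (x₁ t₀ / y₁ t₀) ^ 2 < 1 := by nlinarith [pow_pos hcos 2]
  have habs := abs_lt.1 ((sq_lt_one_iff_abs_lt_one _).1 hlt)
  -- The phase must satisfy `sin u₀ = -x'/y'` and `cos u₀ = x/A`. The arcsine has nonnegative
  -- cosine, which is the right sign because `x > 0`.
  set u₀ := Real.arcsin (-(x₁ t₀ / y₁ t₀)) with hu₀
  refine ⟨A, y t₀ / A - u₀, hA, ?_⟩
  have hu : ∀ t ∈ I, HasDerivAt (fun t => y t / A - (y t₀ / A - u₀)) (y₁ t / A) t :=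
    fun t ht => ((hy t ht).div_const A).sub_const _
  have hsol := trigonometric_system hI hc (p := fun t => x t / A) (q := fun t => x₁ t / y₁ t) hu
    (fun t ht => by
      refine ((hx t ht).div_const A).congr_deriv ?_
      have := hy0 t ht
      field_simp)
    (fun t ht => by
      refine (hq t ht).congr_deriv ?_
      field_simp) ht₀
    (by
      simp only [sub_sub_cancel]
      rw [hu₀, Real.cos_arcsin, neg_sq, ← hunit, add_sub_cancel_right, Real.sqrt_sq hcos.le])
    (by
      simp only [sub_sub_cancel]
      rw [hu₀, Real.sin_arcsin (by linarith [habs.2]) (by linarith [habs.1]), neg_neg])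
  have hpos : ∀ t ∈ I, 0 < Real.cos (y t / A - (y t₀ / A - u₀)) := fun t ht => by
    rw [← hsol t ht]
    exact div_pos (hx0 t ht) hA
  have hucont : ContinuousOn (fun t => y t / A - (y t₀ / A - u₀)) I :=
    fun t ht => (hu t ht).continuousAt.continuousWithinAt
  have hmem₀ : u₀ ∈ Ioo (-(Real.pi / 2)) (Real.pi / 2) :=
    ⟨Real.neg_pi_div_two_lt_arcsin.2 (by linarith [habs.2]),
      Real.arcsin_lt_pi_div_two.2 (by linarith [habs.1])⟩
  refine fun t ht => ⟨⟨?_, ?_⟩, by rw [← hsol t ht]; field_simp⟩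
  -- The phase starts inside `(-π/2, π/2)` and cannot reach an endpoint, where the cosine vanishes
  -- although `x > 0`.
  · have := IsPreconnected.pos_of_ne_zero hc
      (f := fun t => y t / A - (y t₀ / A - u₀) + Real.pi / 2) (hucont.add continuousOn_const)
      (fun t ht h => by
        have h1 := hpos t ht
        rw [eq_neg_of_add_eq_zero_left h] at h1
        simp at h1) ht₀ (by simp only [sub_sub_cancel]; linarith [hmem₀.1]) t ht
    linarith
  · have := IsPreconnected.pos_of_ne_zero hc
      (f := fun t => Real.pi / 2 - (y t / A - (y t₀ / A - u₀))) (continuousOn_const.sub hucont)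
      (fun t ht h => by
        have h1 := hpos t ht
        rw [← sub_eq_zero.1 h] at h1
        simp at h1) ht₀ (by simp only [sub_sub_cancel]; linarith [hmem₀.2]) t ht
    linarith

/-- Reduction of the profile curve equation with spacelike axis to a hyperbolic system. -/
theorem spacelike_axis_profile (hI : IsOpen I) (hc : IsPreconnected I) (κ : ℝ)
    (hx : ∀ t ∈ I, HasDerivAt x (x₁ t) t) (hx₁ : ∀ t ∈ I, HasDerivAt x₁ (x₂ t) t)
    (hy₁ : ∀ t ∈ I, HasDerivAt y₁ (y₂ t) t)
    (hx0 : ∀ t ∈ I, x t ≠ 0) (hD : ∀ t ∈ I, κ * y₁ t ^ 2 - x₁ t ^ 2 < 0)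
    (hode : ∀ t ∈ I, y₁ t * (κ * y₁ t ^ 2 - x₁ t ^ 2) + x t * (y₁ t * x₂ t - x₁ t * y₂ t) = 0) :
    (∀ t ∈ I, y₁ t = 0) ∨ ∃ A : ℝ, 0 < A ∧ ∀ t ∈ I, y₁ t ≠ 0 ∧
      HasDerivAt (fun t => x t / A) (y₁ t / A * (x₁ t / y₁ t)) t ∧
      HasDerivAt (fun t => x₁ t / y₁ t) (y₁ t / A * (x t / A)) t ∧
      (x₁ t / y₁ t) ^ 2 = κ + (x t / A) ^ 2 := by
  by_cases h : ∀ t ∈ I, y₁ t = 0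
  · exact Or.inl h
  push Not at h
  obtain ⟨t₀, ht₀, hne⟩ := h
  right
  have hint := profile_first_integral hI hc κ hx hx₁ hy₁ (fun t ht => (hD t ht).ne) hode ht₀
  have hN : x t₀ ^ 2 * y₁ t₀ ^ 2 / (κ * y₁ t₀ ^ 2 - x₁ t₀ ^ 2) < 0 := by
    have h1 := hx0 t₀ ht₀
    exact div_neg_of_pos_of_neg (by positivity) (hD t₀ ht₀)
  obtain ⟨A, hA, hAN⟩ : ∃ A : ℝ, 0 < A ∧
      -A ^ 2 = x t₀ ^ 2 * y₁ t₀ ^ 2 / (κ * y₁ t₀ ^ 2 - x₁ t₀ ^ 2) :=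
    ⟨_, Real.sqrt_pos.2 (neg_pos.2 hN), by rw [Real.sq_sqrt (neg_pos.2 hN).le, neg_neg]⟩
  rw [← hAN] at hint
  refine ⟨A, hA, fun t ht => ?_⟩
  -- A zero of `y'` would make one side of the first integral vanish while the other is `-A²` times
  -- a negative number.
  have hy0 : y₁ t ≠ 0 := fun h0 => by
    have h1 := hint t ht
    have h2 := hD t ht
    rw [h0] at h1 h2
    nlinarith [mul_pos (pow_pos hA 2) (neg_pos.2 h2)]
  refine ⟨hy0, ?_, ?_, ?_⟩
  · refine ((hx t ht).div_const A).congr_deriv ?_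
    field_simp
  · refine (profile_slope_hasDerivAt κ (hx₁ t ht) (hy₁ t ht) (neg_ne_zero.2 (pow_pos hA 2).ne')
      (hx0 t ht) hy0 (hode t ht) (hint t ht)).congr_deriv ?_
    field_simp
  · field_simp
    linear_combination -hint t ht

/-- Profile curves with lightlike axis. -/
theorem parabolic_profile {a b a₁ b₁ a₂ b₂ : ℝ → ℝ} (hI : IsOpen I) (hc : IsConnected I)
    (ha : ∀ t ∈ I, HasDerivAt a (a₁ t) t) (ha₁ : ∀ t ∈ I, HasDerivAt a₁ (a₂ t) t)
    (hb : ∀ t ∈ I, HasDerivAt b (b₁ t) t) (hb₁ : ∀ t ∈ I, HasDerivAt b₁ (b₂ t) t)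
    (ha0 : ∀ t ∈ I, a t ≠ 0) (hD : ∀ t ∈ I, a₁ t * b₁ t < 0)
    (hode : ∀ t ∈ I, 2 * a₁ t ^ 2 * b₁ t = a t * (a₁ t * b₂ t - b₁ t * a₂ t)) :
    ∃ A d : ℝ, 0 < A ∧ ∀ t ∈ I, b t = d - a t ^ 3 / (6 * A ^ 2) := by
  obtain ⟨t₀, ht₀⟩ := hc.nonempty
  have hc := hc.isPreconnected
  have ha10 : ∀ t ∈ I, a₁ t ≠ 0 := fun t ht h => by
    have := hD t ht
    simp [h] at this
  have hden : ∀ t ∈ I, a₁ t * a t ^ 2 ≠ 0 := fun t ht =>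
    mul_ne_zero (ha10 t ht) (pow_ne_zero _ (ha0 t ht))
  have hconst : ∀ t ∈ I, b₁ t / (a₁ t * a t ^ 2) = b₁ t₀ / (a₁ t₀ * a t₀ ^ 2) := fun t ht =>
    hI.eq_of_hasDerivAt_zero hc (f := fun t => b₁ t / (a₁ t * a t ^ 2)) (fun t ht => by
      refine ((hb₁ t ht).div ((ha₁ t ht).mul ((ha t ht).pow 2)) (hden t ht)).congr_deriv ?_
      rw [div_eq_zero_iff]
      left
      simp only [Pi.mul_apply, Pi.pow_apply]
      push_cast
      linear_combination -a t * hode t ht) ht ht₀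
  have hneg : b₁ t₀ / (a₁ t₀ * a t₀ ^ 2) < 0 := by
    have h1 := hD t₀ ht₀
    have h2 := ha10 t₀ ht₀
    have h3 := ha0 t₀ ht₀
    have : b₁ t₀ / (a₁ t₀ * a t₀ ^ 2) = a₁ t₀ * b₁ t₀ / (a₁ t₀ * a t₀) ^ 2 := by
      field_simp
    rw [this]
    exact div_neg_of_neg_of_pos h1 (by positivity)
  set k := b₁ t₀ / (a₁ t₀ * a t₀ ^ 2) with hk
  -- Integrating `b' = k a² a'` gives `b = k a³/3 + const`; matching `-a³/(6A²)` forces `A² =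
  -- -1/(2k)`.
  have hA : 0 < -1 / (2 * k) := div_pos_of_neg_of_neg (by norm_num) (by linarith)
  refine ⟨√(-1 / (2 * k)), b t₀ - k * a t₀ ^ 3 / 3, Real.sqrt_pos.2 hA, fun t ht => ?_⟩
  have := hI.eq_of_hasDerivAt_zero hc (f := fun t => b t - k * a t ^ 3 / 3) (fun t ht => by
    refine ((hb t ht).sub ((((ha t ht).pow 3).const_mul k).div_const 3)).congr_deriv ?_
    have h1 := (div_eq_iff (hden t ht)).1 (hconst t ht)
    push_cast
    linear_combination h1) ht ht₀
  rw [Real.sq_sqrt hA.le, ← this]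
  field_simp
  ring

end ODE

/-! ### Partial derivatives of the four normal forms -/

theorem hasDerivAt_vec3 {f g h : ℝ → ℝ} {f' g' h' t : ℝ} (hf : HasDerivAt f f' t)
    (hg : HasDerivAt g g' t) (hh : HasDerivAt h h' t) :
    HasDerivAt (fun t => (![f t, g t, h t] : L3)) ![f', g', h'] t := by
  rw [hasDerivAt_pi]
  intro i
  fin_cases i
  exacts [hf, hg, hh]

theorem partial₁_revElliptic {a b : ℝ → ℝ} {p : ℝ × ℝ} {a' b' : ℝ} (ha : HasDerivAt a a' p.1)
    (hb : HasDerivAt b b' p.1) :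
    partial₁ (revElliptic a b) p = ![a', b' * Real.cos p.2, b' * Real.sin p.2] := by
  change deriv (fun t => (![a t, b t * Real.cos p.2, b t * Real.sin p.2] : L3)) p.1 = _
  exact (hasDerivAt_vec3 ha (hb.mul_const _) (hb.mul_const _)).deriv

theorem partial₂_revElliptic (a b : ℝ → ℝ) (p : ℝ × ℝ) :
    partial₂ (revElliptic a b) p = ![0, -(b p.1 * Real.sin p.2), b p.1 * Real.cos p.2] := by
  change deriv (fun s => (![a p.1, b p.1 * Real.cos s, b p.1 * Real.sin s] : L3)) p.2 = _
  refine ((hasDerivAt_vec3 (hasDerivAt_const _ _) ((Real.hasDerivAt_cos _).const_mul _)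
    ((Real.hasDerivAt_sin _).const_mul _)).congr_deriv ?_).deriv
  simp

theorem partial₂_partial₂_revElliptic (a b : ℝ → ℝ) (p : ℝ × ℝ) :
    partial₂ (partial₂ (revElliptic a b)) p =
      ![0, -(b p.1 * Real.cos p.2), -(b p.1 * Real.sin p.2)] := by
  rw [funext (partial₂_revElliptic a b)]
  change deriv (fun s => (![0, -(b p.1 * Real.sin s), b p.1 * Real.cos s] : L3)) p.2 = _
  refine ((hasDerivAt_vec3 (hasDerivAt_const _ _) ((Real.hasDerivAt_sin _).const_mul _).neg
    ((Real.hasDerivAt_cos _).const_mul _)).congr_deriv ?_).deriv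
  simp

theorem partial₁_revHyperbolic {a b : ℝ → ℝ} {p : ℝ × ℝ} {a' b' : ℝ} (ha : HasDerivAt a a' p.1)
    (hb : HasDerivAt b b' p.1) :
    partial₁ (revHyperbolic a b) p = ![a' * Real.cosh p.2, a' * Real.sinh p.2, b'] := by
  change deriv (fun t => (![a t * Real.cosh p.2, a t * Real.sinh p.2, b t] : L3)) p.1 = _
  exact (hasDerivAt_vec3 (ha.mul_const _) (ha.mul_const _) hb).deriv

theorem partial₂_revHyperbolic (a b : ℝ → ℝ) (p : ℝ × ℝ) :
    partial₂ (revHyperbolic a b) p = ![a p.1 * Real.sinh p.2, a p.1 * Real.cosh p.2, 0] := by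
  change deriv (fun s => (![a p.1 * Real.cosh s, a p.1 * Real.sinh s, b p.1] : L3)) p.2 = _
  exact (hasDerivAt_vec3 ((Real.hasDerivAt_cosh _).const_mul _) ((Real.hasDerivAt_sinh _).const_mul _)
    (hasDerivAt_const _ _)).deriv

theorem partial₂_partial₂_revHyperbolic (a b : ℝ → ℝ) (p : ℝ × ℝ) :
    partial₂ (partial₂ (revHyperbolic a b)) p =
      ![a p.1 * Real.cosh p.2, a p.1 * Real.sinh p.2, 0] := by
  rw [funext (partial₂_revHyperbolic a b)]
  change deriv (fun s => (![a p.1 * Real.sinh s, a p.1 * Real.cosh s, 0] : L3)) p.2 = _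
  exact (hasDerivAt_vec3 ((Real.hasDerivAt_sinh _).const_mul _)
    ((Real.hasDerivAt_cosh _).const_mul _) (hasDerivAt_const _ _)).deriv

theorem partial₁_revSpacelikeProfile {a b : ℝ → ℝ} {p : ℝ × ℝ} {a' b' : ℝ}
    (ha : HasDerivAt a a' p.1) (hb : HasDerivAt b b' p.1) :
    partial₁ (revSpacelikeProfile a b) p = ![a' * Real.sinh p.2, a' * Real.cosh p.2, b'] := by
  change deriv (fun t => (![a t * Real.sinh p.2, a t * Real.cosh p.2, b t] : L3)) p.1 = _
  exact (hasDerivAt_vec3 (ha.mul_const _) (ha.mul_const _) hb).deriv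

theorem partial₂_revSpacelikeProfile (a b : ℝ → ℝ) (p : ℝ × ℝ) :
    partial₂ (revSpacelikeProfile a b) p = ![a p.1 * Real.cosh p.2, a p.1 * Real.sinh p.2, 0] := by
  change deriv (fun s => (![a p.1 * Real.sinh s, a p.1 * Real.cosh s, b p.1] : L3)) p.2 = _
  exact (hasDerivAt_vec3 ((Real.hasDerivAt_sinh _).const_mul _) ((Real.hasDerivAt_cosh _).const_mul _)
    (hasDerivAt_const _ _)).deriv

theorem partial₂_partial₂_revSpacelikeProfile (a b : ℝ → ℝ) (p : ℝ × ℝ) :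
    partial₂ (partial₂ (revSpacelikeProfile a b)) p =
      ![a p.1 * Real.sinh p.2, a p.1 * Real.cosh p.2, 0] := by
  rw [funext (partial₂_revSpacelikeProfile a b)]
  change deriv (fun s => (![a p.1 * Real.cosh s, a p.1 * Real.sinh s, 0] : L3)) p.2 = _
  exact (hasDerivAt_vec3 ((Real.hasDerivAt_cosh _).const_mul _)
    ((Real.hasDerivAt_sinh _).const_mul _) (hasDerivAt_const _ _)).deriv

/-- `L₁` spans the lightlike axis. Since `L₁`, `L₂` are null with product `1`, null coordinates
remove the factors `√2` from the metric and the determinants. -/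
theorem revParabolic_eq_nullFrame (a b : ℝ → ℝ) (p : ℝ × ℝ) :
    revParabolic a b p = nullFrame (b p.1 - a p.1 * p.2 ^ 2 / 2) (a p.1) (p.2 * a p.1) := by
  have h2 : √2 ^ 2 = (2 : ℝ) := Real.sq_sqrt (by norm_num)
  ext i
  fin_cases i
  · simp [revParabolic, nullFrame]
    field_simp
    simp only [h2]
    ring
  · simp [revParabolic, nullFrame]
    field_simp
    simp only [h2]
    ring
  · simp [revParabolic, nullFrame]

theorem hasDerivAt_nullFrame {f g h : ℝ → ℝ} {f' g' h' t : ℝ} (hf : HasDerivAt f f' t)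
    (hg : HasDerivAt g g' t) (hh : HasDerivAt h h' t) :
    HasDerivAt (fun t => nullFrame (f t) (g t) (h t)) (nullFrame f' g' h') t :=
  ((hf.smul_const (![-(√2 / 2), √2 / 2, 0] : L3)).add
    (hg.smul_const (![√2 / 2, √2 / 2, 0] : L3))).add (hh.smul_const (![0, 0, 1] : L3))

theorem lorentzInner_nullFrame (x y z x' y' z' : ℝ) :
    lorentzInner (nullFrame x y z) (nullFrame x' y' z') = x * y' + y * x' + z * z' := by
  have h2 : √2 * √2 = (2 : ℝ) := Real.mul_self_sqrt (by norm_num)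
  simp [lorentzInner, nullFrame]
  linear_combination (x * y' + y * x') / 2 * h2

theorem det_nullFrame (x y z x' y' z' x'' y'' z'' : ℝ) :
    (Matrix.of ![nullFrame x y z, nullFrame x' y' z', nullFrame x'' y'' z'']).det =
      -(Matrix.of ![![x, y, z], ![x', y', z'], ![x'', y'', z'']]).det := by
  have h2 : √2 * √2 = (2 : ℝ) := Real.mul_self_sqrt (by norm_num)
  simp [nullFrame, Matrix.det_fin_three]
  linear_combination -(x * y' * z'' - x * z' * y'' - y * x' * z'' + y * z' * x'' + z * x' * y''
    - z * y' * x'') / 2 * h2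

theorem partial₁_revParabolic {a b : ℝ → ℝ} {p : ℝ × ℝ} {a' b' : ℝ}
    (ha : HasDerivAt a a' p.1) (hb : HasDerivAt b b' p.1) :
    partial₁ (revParabolic a b) p = nullFrame (b' - a' * p.2 ^ 2 / 2) a' (p.2 * a') := by
  rw [funext (revParabolic_eq_nullFrame a b)]
  change deriv (fun t => nullFrame (b t - a t * p.2 ^ 2 / 2) (a t) (p.2 * a t)) p.1 = _
  exact (hasDerivAt_nullFrame (hb.sub ((ha.mul_const _).div_const 2)) ha (ha.const_mul _)).deriv

theorem partial₂_revParabolic (a b : ℝ → ℝ) (p : ℝ × ℝ) :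
    partial₂ (revParabolic a b) p = nullFrame (-(a p.1 * p.2)) 0 (a p.1) := by
  rw [funext (revParabolic_eq_nullFrame a b)]
  change deriv (fun s => nullFrame (b p.1 - a p.1 * s ^ 2 / 2) (a p.1) (s * a p.1)) p.2 = _
  have h : HasDerivAt (fun s => b p.1 - a p.1 * s ^ 2 / 2) (-(a p.1 * p.2)) p.2 := by
    refine ((((hasDerivAt_pow 2 p.2).const_mul _).div_const 2).const_sub _).congr_deriv ?_
    push_cast
    ring
  exact (hasDerivAt_nullFrame h (hasDerivAt_const _ _) (hasDerivAt_mul_const _)).deriv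

theorem partial₂_partial₂_revParabolic (a b : ℝ → ℝ) (p : ℝ × ℝ) :
    partial₂ (partial₂ (revParabolic a b)) p = nullFrame (-a p.1) 0 0 := by
  rw [funext (partial₂_revParabolic a b)]
  change deriv (fun s => nullFrame (-(a p.1 * s)) 0 (a p.1)) p.2 = _
  exact (hasDerivAt_nullFrame (hasDerivAt_const_mul _).neg
    (hasDerivAt_const _ _) (hasDerivAt_const _ _)).deriv

/-- Sign changes of the coordinates. -/
theorem isCongruence_signs {σ τ ρ : ℝ} (hσ : σ ^ 2 = 1) (hτ : τ ^ 2 = 1) (hρ : ρ ^ 2 = 1) :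
    IsCongruence fun x => ![σ * x 0, τ * x 1, ρ * x 2] := by
  refine ⟨{ toFun := fun x => ![σ * x 0, τ * x 1, ρ * x 2], map_add' := fun x y => ?_,
            map_smul' := fun r x => ?_ }, 0, fun x y => ?_, fun x => by simp⟩
  · ext i
    fin_cases i <;> simp [mul_add]
  · ext i
    fin_cases i <;> simp [mul_left_comm]
  · simp [lorentzInner]
    linear_combination -(x 0 * y 0) * hσ + x 1 * y 1 * hτ + x 2 * y 2 * hρ

/-- A pointwise criterion for congruence to a part of a model surface, with a change of
parameters acting on the two factors. -/
theorem congruentToPart_of_prod {X Y : ℝ × ℝ → L3} {I J : Set ℝ} {D : Set (ℝ × ℝ)}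
    {Φ : L3 → L3} (hΦ : IsCongruence Φ) {u v : ℝ → ℝ} (hu : IsOpen (u '' I))
    (hv : IsOpen (v '' J)) (hD : ∀ t ∈ I, ∀ s ∈ J, (u t, v s) ∈ D)
    (h : ∀ t ∈ I, ∀ s ∈ J, Φ (X (t, s)) = Y (u t, v s)) :
    CongruentToPart (X '' (I ×ˢ J)) Y D := by
  refine ⟨Φ, hΦ, (u '' I) ×ˢ (v '' J), ?_, hu.prod hv, ?_⟩
  · rintro ⟨_, _⟩ ⟨⟨t, ht, rfl⟩, s, hs, rfl⟩
    exact hD t ht s hs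
  · rw [← prodMap_image_prod, image_image, image_image]
    exact image_congr fun p hp => h p.1 hp.1 p.2 hp.2

theorem analyticOnNhd_profile {f : ℝ × ℝ → ℝ} {I J : Set ℝ} (hf : AnalyticOnNhd ℝ f (I ×ˢ J))
    {s : ℝ} (hs : s ∈ J) : AnalyticOnNhd ℝ (fun t => f (t, s)) I :=
  hf.comp (g := f) (f := fun t => (t, s)) (analyticOnNhd_id.prod analyticOnNhd_const)
    fun _ ht => ⟨ht, hs⟩

theorem exists_sign {x : ℝ} (hx : x ≠ 0) : ∃ σ : ℝ, σ ^ 2 = 1 ∧ 0 < σ * x := by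
  rcases hx.lt_or_gt with h | h
  · exact ⟨-1, by norm_num, by linarith⟩
  · exact ⟨1, by norm_num, by linarith⟩

/-! ### Timelike axis -/

section Cases

variable {a b : ℝ → ℝ} {I J : Set ℝ}

theorem AnalyticOnNhd.coord {X : ℝ × ℝ → L3} {U : Set (ℝ × ℝ)} (h : AnalyticOnNhd ℝ X U)
    (i : Fin 3) : AnalyticOnNhd ℝ (fun p => X p i) U :=
  (ContinuousLinearMap.proj (R := ℝ) (φ := fun _ : Fin 3 => ℝ) i).comp_analyticOnNhd h

theorem revElliptic_congruent (hI : IsOpen I) (hIc : IsConnected I) (hJ : IsOpen J)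
    (hJn : J.Nonempty) (han : AnalyticOnNhd ℝ (revElliptic a b) (I ×ˢ J))
    (ht : IsTimelikeOn (revElliptic a b) (I ×ˢ J))
    (hm : ∀ p ∈ I ×ˢ J, minimalNumerator (revElliptic a b) p = 0) :
    ∃ A θ : ℝ, 0 < A ∧ CongruentToPart (revElliptic a b '' (I ×ˢ J)) (ellipticCatenoid A θ)
      ellipticCatenoidDomain := by
  obtain ⟨s, hs⟩ := hJn
  have haa : AnalyticOnNhd ℝ a I := analyticOnNhd_profile (han.coord 0) hs
  -- The radius is recovered from the surface as `X₁ cos s + X₂ sin s`.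
  have hba : AnalyticOnNhd ℝ b I := by
    have h := ((analyticOnNhd_profile (han.coord 1) hs).mul
      (analyticOnNhd_const (v := Real.cos s))).add
      ((analyticOnNhd_profile (han.coord 2) hs).mul (analyticOnNhd_const (v := Real.sin s)))
    refine h.congr hI fun t _ => ?_
    simp [revElliptic]
    linear_combination b t * Real.sin_sq_add_cos_sq s
  obtain ⟨ha, ha'⟩ := haa.hasDerivAt_deriv
  obtain ⟨hb, hb'⟩ := hba.hasDerivAt_deriv
  set a₁ := deriv a
  set b₁ := deriv b
  set a₂ := deriv a₁
  set b₂ := deriv b₁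
  have hU := hI.prod hJ
  have h1 : EqOn (partial₁ (revElliptic a b)) (revElliptic a₁ b₁) (I ×ˢ J) :=
    fun p hp => partial₁_revElliptic (ha _ hp.1) (hb _ hp.1)
  have hE : ∀ t ∈ I, coeffE (revElliptic a b) (t, s) = b₁ t ^ 2 - a₁ t ^ 2 := fun t ht => by
    rw [coeffE, h1 (mk_mem_prod ht hs)]
    simp [lorentzInner, revElliptic]
    linear_combination b₁ t ^ 2 * Real.sin_sq_add_cos_sq s
  have hF : ∀ t ∈ I, coeffF (revElliptic a b) (t, s) = 0 := fun t ht => by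
    rw [coeffF, h1 (mk_mem_prod ht hs), partial₂_revElliptic]
    simp [lorentzInner, revElliptic]
    ring
  have hG : ∀ t ∈ I, coeffG (revElliptic a b) (t, s) = b t ^ 2 := fun t ht => by
    rw [coeffG, partial₂_revElliptic]
    simp [lorentzInner]
    linear_combination b t ^ 2 * Real.sin_sq_add_cos_sq s
  have htl : ∀ t ∈ I, (b₁ t ^ 2 - a₁ t ^ 2) * b t ^ 2 < 0 := fun t h => by
    simpa [hE t h, hF t h, hG t h] using ht (t, s) (mk_mem_prod h hs)
  have hb0 : ∀ t ∈ I, b t ≠ 0 := fun t h h0 => by simpa [h0] using htl t h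
  have hD : ∀ t ∈ I, b₁ t ^ 2 < a₁ t ^ 2 := fun t h => by
    nlinarith [htl t h, pow_pos (abs_pos.2 (hb0 t h)) 2, sq_abs (b t)]
  have hode : ∀ t ∈ I, a₁ t * (a₁ t ^ 2 - b₁ t ^ 2) + b t * (a₁ t * b₂ t - b₁ t * a₂ t) = 0 :=
    fun t h => by
    have hp := mk_mem_prod h hs
    have := hm (t, s) hp
    rw [minimalNumerator, hE t h, hF t h, hG t h, partial₁_eqOn hU h1 hp, h1 hp,
      partial₂_partial₂_revElliptic, partial₂_revElliptic,
      partial₁_revElliptic (ha' t h) (hb' t h)] at this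
    refine (mul_eq_zero.1 (Eq.trans ?_ this)).resolve_left (neg_ne_zero.2 (pow_ne_zero 2 (hb0 t h)))
    simp [Matrix.det_fin_three, revElliptic]
    linear_combination (b t ^ 2 * (a₁ t * (a₁ t ^ 2 - b₁ t ^ 2) +
      b t * (a₁ t * b₂ t - b₁ t * a₂ t))) * Real.sin_sq_add_cos_sq s
  obtain ⟨t₀, ht₀⟩ := hIc.nonempty
  -- The radius has no zeros, hence a constant sign, which a reflection makes positive.
  obtain ⟨σ, hσ, hpos⟩ := exists_sign (hb0 t₀ ht₀)
  have hσ0 : σ ≠ 0 := fun h => by simp [h] at hσ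
  have hσb : ∀ t ∈ I, 0 < σ * b t := hIc.isPreconnected.pos_of_ne_zero
    (continuousOn_const.mul hba.continuousOn) (fun t h => mul_ne_zero hσ0 (hb0 t h)) ht₀ hpos
  obtain ⟨A, θ, hA, h⟩ := elliptic_profile hI hIc (fun t h => (hb t h).const_mul σ)
    (fun t h => (hb' t h).const_mul σ) ha ha' hσb
    (fun t h => by rw [mul_pow, hσ, one_mul]; exact hD t h)
    (fun t h => by
      linear_combination hode t h + (b t * (a₁ t * b₂ t - b₁ t * a₂ t) - a₁ t * b₁ t ^ 2) * hσ)
  have ha10 : ∀ t ∈ I, a₁ t ≠ 0 := fun t h h0 => by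
    have := hD t h
    rw [h0] at this
    nlinarith [sq_nonneg (b₁ t)]
  refine ⟨A, θ, hA, congruentToPart_of_prod (isCongruence_signs (one_pow 2) hσ hσ)
    (u := fun t => a t / A - θ) (v := id) ?_ (by simpa using hJ)
    (fun t ht s _ => ⟨(h t ht).1, mem_univ _⟩) (fun t ht s _ => ?_)⟩
  · refine AnalyticOnNhd.isOpen_image_of_deriv_ne_zero hI
      ((haa.div analyticOnNhd_const fun _ _ => hA.ne').sub analyticOnNhd_const) fun t h => ?_
    rw [(((ha t h).div_const A).sub_const θ).deriv]
    exact div_ne_zero (ha10 t h) hA.ne'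
  · have h2 := (h t ht).2
    ext i
    fin_cases i
    · simp [revElliptic, ellipticCatenoid]
      field_simp
    · simp [revElliptic, ellipticCatenoid]
      linear_combination Real.cos s * h2
    · simp [revElliptic, ellipticCatenoid]
      linear_combination Real.sin s * h2

end Cases

/-! ### Spacelike axis -/

section SpacelikeAxis

variable {a b : ℝ → ℝ} {I J : Set ℝ}

theorem revHyperbolic_congruent (hI : IsOpen I) (hIc : IsConnected I) (hJ : IsOpen J)
    (hJn : J.Nonempty) (han : AnalyticOnNhd ℝ (revHyperbolic a b) (I ×ˢ J))
    (ht : IsTimelikeOn (revHyperbolic a b) (I ×ˢ J))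
    (hm : ∀ p ∈ I ×ˢ J, minimalNumerator (revHyperbolic a b) p = 0)
    (hpl : ¬ IsPlanarOn (revHyperbolic a b) (I ×ˢ J)) :
    ∃ A θ : ℝ, 0 < A ∧ CongruentToPart (revHyperbolic a b '' (I ×ˢ J)) (hyperbolicCatenoid A θ)
      hyperbolicCatenoidDomain := by
  obtain ⟨s, hs⟩ := hJn
  have hba : AnalyticOnNhd ℝ b I := analyticOnNhd_profile (han.coord 2) hs
  have haa : AnalyticOnNhd ℝ a I := by
    have h := ((analyticOnNhd_profile (han.coord 0) hs).mul
      (analyticOnNhd_const (v := Real.cosh s))).sub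
      ((analyticOnNhd_profile (han.coord 1) hs).mul (analyticOnNhd_const (v := Real.sinh s)))
    refine h.congr hI fun t _ => ?_
    simp [revHyperbolic]
    linear_combination a t * Real.cosh_sq_sub_sinh_sq s
  obtain ⟨ha, ha'⟩ := haa.hasDerivAt_deriv
  obtain ⟨hb, hb'⟩ := hba.hasDerivAt_deriv
  set a₁ := deriv a
  set b₁ := deriv b
  set a₂ := deriv a₁
  set b₂ := deriv b₁
  have hU := hI.prod hJ
  have h1 : EqOn (partial₁ (revHyperbolic a b)) (revHyperbolic a₁ b₁) (I ×ˢ J) :=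
    fun p hp => partial₁_revHyperbolic (ha _ hp.1) (hb _ hp.1)
  have hE : ∀ t ∈ I, coeffE (revHyperbolic a b) (t, s) = b₁ t ^ 2 - a₁ t ^ 2 := fun t ht => by
    rw [coeffE, h1 (mk_mem_prod ht hs)]
    simp [lorentzInner, revHyperbolic]
    linear_combination -a₁ t ^ 2 * Real.cosh_sq_sub_sinh_sq s
  have hF : ∀ t ∈ I, coeffF (revHyperbolic a b) (t, s) = 0 := fun t ht => by
    rw [coeffF, h1 (mk_mem_prod ht hs), partial₂_revHyperbolic]
    simp [lorentzInner, revHyperbolic]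
    ring
  have hG : ∀ t ∈ I, coeffG (revHyperbolic a b) (t, s) = a t ^ 2 := fun t ht => by
    rw [coeffG, partial₂_revHyperbolic]
    simp [lorentzInner]
    linear_combination a t ^ 2 * Real.cosh_sq_sub_sinh_sq s
  have htl : ∀ t ∈ I, (b₁ t ^ 2 - a₁ t ^ 2) * a t ^ 2 < 0 := fun t h => by
    simpa [hE t h, hF t h, hG t h] using ht (t, s) (mk_mem_prod h hs)
  have ha0 : ∀ t ∈ I, a t ≠ 0 := fun t h h0 => by simpa [h0] using htl t h
  have hD : ∀ t ∈ I, 1 * b₁ t ^ 2 - a₁ t ^ 2 < 0 := fun t h => by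
    have h3 : 0 < a t ^ 2 := by have := ha0 t h; positivity
    nlinarith [htl t h]
  have hode : ∀ t ∈ I, b₁ t * (1 * b₁ t ^ 2 - a₁ t ^ 2) + a t * (b₁ t * a₂ t - a₁ t * b₂ t) = 0 :=
    fun t h => by
    have hp := mk_mem_prod h hs
    have := hm (t, s) hp
    rw [minimalNumerator, hE t h, hF t h, hG t h, partial₁_eqOn hU h1 hp, h1 hp,
      partial₂_partial₂_revHyperbolic, partial₂_revHyperbolic,
      partial₁_revHyperbolic (ha' t h) (hb' t h)] at this
    refine (mul_eq_zero.1 (Eq.trans ?_ this)).resolve_left (neg_ne_zero.2 (pow_ne_zero 2 (ha0 t h)))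
    simp [Matrix.det_fin_three, revHyperbolic]
    linear_combination (a t ^ 2 * (b₁ t * (1 * b₁ t ^ 2 - a₁ t ^ 2) +
      a t * (b₁ t * a₂ t - a₁ t * b₂ t))) * Real.cosh_sq_sub_sinh_sq s
  obtain ⟨t₀, ht₀⟩ := hIc.nonempty
  rcases spacelike_axis_profile hI hIc.isPreconnected 1 ha ha' hb' ha0 hD hode with h | ⟨A, hA, h⟩
  · refine (hpl ⟨![0, 0, 1], b t₀, fun h => by simpa using congrFun h 2, fun p hp => ?_⟩).elim
    have := hI.eq_of_hasDerivAt_zero hIc.isPreconnected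
      (fun t ht => (hb t ht).congr_deriv (h t ht)) hp.1 ht₀
    simp [lorentzInner, revHyperbolic, this]
  have hq0 : a₁ t₀ / b₁ t₀ ≠ 0 := fun h0 => by
    have := (h t₀ ht₀).2.2.2
    rw [h0] at this
    nlinarith [sq_nonneg (a t₀ / A)]
  obtain ⟨σ, hσ, hσpos⟩ := exists_sign (ha0 t₀ ht₀)
  -- `σ` makes the radius positive, so that `u > 0`; `τ` reverses the axis if needed, so that the
  -- slope is `+cosh u` and not `-cosh u`.
  obtain ⟨τ, hτ, hτpos⟩ := exists_sign (mul_ne_zero (by rintro rfl; simp at hσ : σ ≠ 0) hq0)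
  have hσ0 : σ ≠ 0 := fun h => by simp [h] at hσ
  have hτ0 : τ ≠ 0 := fun h => by simp [h] at hτ
  set u₀ := Real.arsinh (σ * (a t₀ / A)) with hu₀
  have hsol := hyperbolic_system hI hIc.isPreconnected (p := fun t => σ * (a t / A))
    (q := fun t => τ * (σ * (a₁ t / b₁ t))) (u := fun t => τ * b t / A - (τ * b t₀ / A - u₀))
    (ω := fun t => τ * b₁ t / A)
    (fun t ht => (((hb t ht).const_mul τ).div_const A).sub_const _)
    (fun t ht => ((h t ht).2.1.const_mul σ).congr_deriv (by
      linear_combination -(b₁ t / A * (a₁ t / b₁ t) * σ) * hτ))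
    (fun t ht => (((h t ht).2.2.1.const_mul σ).const_mul τ).congr_deriv (by ring)) ht₀
    (by simp only [sub_sub_cancel]; rw [hu₀, Real.sinh_arsinh])
    (by
      simp only [sub_sub_cancel]
      rw [hu₀, Real.cosh_arsinh, ← Real.sqrt_sq hτpos.le]
      congr 1
      linear_combination (h t₀ ht₀).2.2.2 + (σ ^ 2 * (a₁ t₀ / b₁ t₀) ^ 2) * hτ
        + ((a₁ t₀ / b₁ t₀) ^ 2 - (a t₀ / A) ^ 2) * hσ)
  have hpos : ∀ t ∈ I, 0 < σ * a t := hIc.isPreconnected.pos_of_ne_zero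
    (continuousOn_const.mul haa.continuousOn) (fun t h => mul_ne_zero hσ0 (ha0 t h)) ht₀ hσpos
  refine ⟨A, u₀ - τ * b t₀ / A, hA, congruentToPart_of_prod (isCongruence_signs hσ hσ hτ)
    (u := fun t => τ * b t / A - (τ * b t₀ / A - u₀)) (v := id) ?_ (by simpa using hJ)
    (fun t ht s _ => ⟨?_, mem_univ _⟩) (fun t ht s _ => ?_)⟩
  · refine AnalyticOnNhd.isOpen_image_of_deriv_ne_zero hI
      (((analyticOnNhd_const.mul hba).div analyticOnNhd_const fun _ _ => hA.ne').sub
        analyticOnNhd_const) fun t ht => ?_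
    rw [((((hb t ht).const_mul τ).div_const A).sub_const _).deriv]
    exact div_ne_zero (mul_ne_zero hτ0 (h t ht).1) hA.ne'
  · rw [mem_Ioi, ← Real.sinh_pos_iff, ← (hsol t ht).1, ← mul_div_assoc]
    exact div_pos (hpos t ht) hA
  · have h2 := (hsol t ht).1
    ext i
    fin_cases i
    · simp [revHyperbolic, hyperbolicCatenoid, ← h2]
      field_simp
    · simp [revHyperbolic, hyperbolicCatenoid, ← h2]
      field_simp
    · simp [revHyperbolic, hyperbolicCatenoid]
      field_simp
      ring

theorem revSpacelikeProfile_congruent (hI : IsOpen I) (hIc : IsConnected I) (hJ : IsOpen J)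
    (hJn : J.Nonempty) (han : AnalyticOnNhd ℝ (revSpacelikeProfile a b) (I ×ˢ J))
    (ht : IsTimelikeOn (revSpacelikeProfile a b) (I ×ˢ J))
    (hm : ∀ p ∈ I ×ˢ J, minimalNumerator (revSpacelikeProfile a b) p = 0)
    (hpl : ¬ IsPlanarOn (revSpacelikeProfile a b) (I ×ˢ J)) :
    ∃ A θ : ℝ, 0 < A ∧ CongruentToPart (revSpacelikeProfile a b '' (I ×ˢ J))
      (spacelikeProfileSurface A θ) univ := by
  obtain ⟨s, hs⟩ := hJn
  have hba : AnalyticOnNhd ℝ b I := analyticOnNhd_profile (han.coord 2) hs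
  have haa : AnalyticOnNhd ℝ a I := by
    have h := ((analyticOnNhd_profile (han.coord 1) hs).mul
      (analyticOnNhd_const (v := Real.cosh s))).sub
      ((analyticOnNhd_profile (han.coord 0) hs).mul (analyticOnNhd_const (v := Real.sinh s)))
    refine h.congr hI fun t _ => ?_
    simp [revSpacelikeProfile]
    linear_combination a t * Real.cosh_sq_sub_sinh_sq s
  obtain ⟨ha, ha'⟩ := haa.hasDerivAt_deriv
  obtain ⟨hb, hb'⟩ := hba.hasDerivAt_deriv
  set a₁ := deriv a
  set b₁ := deriv b
  set a₂ := deriv a₁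
  set b₂ := deriv b₁
  have hU := hI.prod hJ
  have h1 : EqOn (partial₁ (revSpacelikeProfile a b)) (revSpacelikeProfile a₁ b₁) (I ×ˢ J) :=
    fun p hp => partial₁_revSpacelikeProfile (ha _ hp.1) (hb _ hp.1)
  have hE : ∀ t ∈ I, coeffE (revSpacelikeProfile a b) (t, s) = b₁ t ^ 2 + a₁ t ^ 2 :=
    fun t ht => by
    rw [coeffE, h1 (mk_mem_prod ht hs)]
    simp [lorentzInner, revSpacelikeProfile]
    linear_combination a₁ t ^ 2 * Real.cosh_sq_sub_sinh_sq s
  have hF : ∀ t ∈ I, coeffF (revSpacelikeProfile a b) (t, s) = 0 := fun t ht => by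
    rw [coeffF, h1 (mk_mem_prod ht hs), partial₂_revSpacelikeProfile]
    simp [lorentzInner, revSpacelikeProfile]
    ring
  have hG : ∀ t ∈ I, coeffG (revSpacelikeProfile a b) (t, s) = -a t ^ 2 := fun t ht => by
    rw [coeffG, partial₂_revSpacelikeProfile]
    simp [lorentzInner]
    linear_combination -a t ^ 2 * Real.cosh_sq_sub_sinh_sq s
  have htl : ∀ t ∈ I, 0 < (b₁ t ^ 2 + a₁ t ^ 2) * a t ^ 2 := fun t h => by
    simpa [hE t h, hF t h, hG t h] using ht (t, s) (mk_mem_prod h hs)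
  have ha0 : ∀ t ∈ I, a t ≠ 0 := fun t h h0 => by simpa [h0] using htl t h
  have hD : ∀ t ∈ I, -1 * b₁ t ^ 2 - a₁ t ^ 2 < 0 := fun t h => by
    have := pos_of_mul_pos_left (htl t h) (sq_nonneg (a t))
    linarith
  have hode : ∀ t ∈ I, b₁ t * (-1 * b₁ t ^ 2 - a₁ t ^ 2) + a t * (b₁ t * a₂ t - a₁ t * b₂ t) = 0 :=
    fun t h => by
    have hp := mk_mem_prod h hs
    have := hm (t, s) hp
    rw [minimalNumerator, hE t h, hF t h, hG t h, partial₁_eqOn hU h1 hp, h1 hp,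
      partial₂_partial₂_revSpacelikeProfile, partial₂_revSpacelikeProfile,
      partial₁_revSpacelikeProfile (ha' t h) (hb' t h)] at this
    refine (mul_eq_zero.1 (Eq.trans ?_ this)).resolve_left (neg_ne_zero.2 (pow_ne_zero 2 (ha0 t h)))
    simp [Matrix.det_fin_three, revSpacelikeProfile]
    linear_combination (a t ^ 2 * (b₁ t * (-1 * b₁ t ^ 2 - a₁ t ^ 2) +
      a t * (b₁ t * a₂ t - a₁ t * b₂ t))) * Real.cosh_sq_sub_sinh_sq s
  obtain ⟨t₀, ht₀⟩ := hIc.nonempty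
  rcases spacelike_axis_profile hI hIc.isPreconnected (-1) ha ha' hb' ha0 hD hode with
    h | ⟨A, hA, h⟩
  · refine (hpl ⟨![0, 0, 1], b t₀, fun h => by simpa using congrFun h 2, fun p hp => ?_⟩).elim
    have := hI.eq_of_hasDerivAt_zero hIc.isPreconnected
      (fun t ht => (hb t ht).congr_deriv (h t ht)) hp.1 ht₀
    simp [lorentzInner, revSpacelikeProfile, this]
  obtain ⟨σ, hσ, hσpos⟩ := exists_sign (ha0 t₀ ht₀)
  -- For `κ = -1` the roles swap: the slope is the `sinh` and the radius the `cosh`, so one sign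
  -- suffices.
  set u₀ := Real.arsinh (σ * (a₁ t₀ / b₁ t₀)) with hu₀
  have hsol := hyperbolic_system hI hIc.isPreconnected (p := fun t => σ * (a₁ t / b₁ t))
    (q := fun t => σ * (a t / A)) (u := fun t => b t / A - (b t₀ / A - u₀))
    (ω := fun t => b₁ t / A)
    (fun t ht => ((hb t ht).div_const A).sub_const _)
    (fun t ht => ((h t ht).2.2.1.const_mul σ).congr_deriv (by ring))
    (fun t ht => ((h t ht).2.1.const_mul σ).congr_deriv (by ring)) ht₀
    (by simp only [sub_sub_cancel]; rw [hu₀, Real.sinh_arsinh])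
    (by
      simp only [sub_sub_cancel]
      have hpos : 0 ≤ σ * (a t₀ / A) := by
        rw [← mul_div_assoc]
        exact (div_pos hσpos hA).le
      rw [hu₀, Real.cosh_arsinh, ← Real.sqrt_sq hpos]
      congr 1
      linear_combination -(h t₀ ht₀).2.2.2 + ((a t₀ / A) ^ 2 - (a₁ t₀ / b₁ t₀) ^ 2) * hσ)
  -- The model has the rotation parameter first, so the parameters are exchanged.
  have hJI : CongruentToPart (revSpacelikeProfile a b '' (I ×ˢ J))
      (spacelikeProfileSurface A (u₀ - b t₀ / A) ∘ Prod.swap) univ := by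
    refine congruentToPart_of_prod (isCongruence_signs hσ hσ (one_pow 2))
      (u := fun t => b t / A - (b t₀ / A - u₀)) (v := id) ?_ (by simpa using hJ)
      (fun t ht s _ => mem_univ _) (fun t ht s _ => ?_)
    · refine AnalyticOnNhd.isOpen_image_of_deriv_ne_zero hI
        ((hba.div analyticOnNhd_const fun _ _ => hA.ne').sub analyticOnNhd_const) fun t ht => ?_
      rw [(((hb t ht).div_const A).sub_const _).deriv]
      exact div_ne_zero (h t ht).1 hA.ne'
    · have h2 := (hsol t ht).2
      ext i
      fin_cases i
      · simp [revSpacelikeProfile, spacelikeProfileSurface, ← h2]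
        field_simp
      · simp [revSpacelikeProfile, spacelikeProfileSurface, ← h2]
        field_simp
      · simp [revSpacelikeProfile, spacelikeProfileSurface]
        field_simp
        ring
  obtain ⟨Φ, hΦ, V, -, hV, hVe⟩ := hJI
  refine ⟨A, _, hA, Φ, hΦ, Prod.swap '' V, subset_univ _, ?_, by rw [hVe, image_comp]⟩
  rw [image_swap_eq_preimage_swap]
  exact hV.preimage continuous_swap

end SpacelikeAxis

/-! ### Lightlike axis -/

section LightlikeAxis

variable {a b : ℝ → ℝ} {I J : Set ℝ}

/-- Translations composed with `± id`. -/
theorem isCongruence_smul_add {σ : ℝ} (hσ : σ ^ 2 = 1) (c : L3) :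
    IsCongruence fun x => σ • x + c :=
  ⟨σ • LinearMap.id, c, fun x y => by
    simp [lorentzInner]
    linear_combination (-(x 0 * y 0) + x 1 * y 1 + x 2 * y 2) * hσ, fun x => by simp⟩

theorem revParabolic_congruent (hI : IsOpen I) (hIc : IsConnected I) (hJ : IsOpen J)
    (hJn : J.Nonempty) (han : AnalyticOnNhd ℝ (revParabolic a b) (I ×ˢ J))
    (ht : IsTimelikeOn (revParabolic a b) (I ×ˢ J))
    (hm : ∀ p ∈ I ×ˢ J, minimalNumerator (revParabolic a b) p = 0) :
    ∃ A B : ℝ, 0 < A ∧ CongruentToPart (revParabolic a b '' (I ×ˢ J)) (parabolicCatenoid A B)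
      (parabolicCatenoidDomain B) := by
  obtain ⟨s, hs⟩ := hJn
  have h0 := analyticOnNhd_profile (han.coord 0) hs
  have h1 := analyticOnNhd_profile (han.coord 1) hs
  have haa : AnalyticOnNhd ℝ a I := by
    refine ((h0.add h1).mul (analyticOnNhd_const (v := √2 / 2))).congr hI fun t _ => ?_
    simp [revParabolic]
    field_simp
    ring
  have hba : AnalyticOnNhd ℝ b I := by
    refine (((h1.sub h0).mul (analyticOnNhd_const (v := √2 / 2))).add
      (haa.mul (analyticOnNhd_const (v := s ^ 2 / 2)))).congr hI fun t _ => ?_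
    simp [revParabolic]
    field_simp
    ring
  obtain ⟨ha, ha'⟩ := haa.hasDerivAt_deriv
  obtain ⟨hb, hb'⟩ := hba.hasDerivAt_deriv
  set a₁ := deriv a
  set b₁ := deriv b
  set a₂ := deriv a₁
  set b₂ := deriv b₁
  have hU := hI.prod hJ
  have h1 : EqOn (partial₁ (revParabolic a b)) (revParabolic a₁ b₁) (I ×ˢ J) :=
    fun p hp => (partial₁_revParabolic (ha _ hp.1) (hb _ hp.1)).trans
      (revParabolic_eq_nullFrame _ _ _).symm
  have hE : ∀ t ∈ I, coeffE (revParabolic a b) (t, s) = 2 * (a₁ t * b₁ t) := fun t ht => by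
    rw [coeffE, h1 (mk_mem_prod ht hs), revParabolic_eq_nullFrame, lorentzInner_nullFrame]
    ring
  have hF : ∀ t ∈ I, coeffF (revParabolic a b) (t, s) = 0 := fun t ht => by
    rw [coeffF, h1 (mk_mem_prod ht hs), revParabolic_eq_nullFrame, partial₂_revParabolic,
      lorentzInner_nullFrame]
    ring
  have hG : ∀ t ∈ I, coeffG (revParabolic a b) (t, s) = a t ^ 2 := fun t ht => by
    rw [coeffG, partial₂_revParabolic, lorentzInner_nullFrame]
    ring
  have htl : ∀ t ∈ I, 2 * (a₁ t * b₁ t) * a t ^ 2 < 0 := fun t h => by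
    simpa only [hE t h, hF t h, hG t h, ne_eq, OfNat.ofNat_ne_zero, not_false_eq_true, zero_pow,
      sub_zero] using ht (t, s) (mk_mem_prod h hs)
  have ha0 : ∀ t ∈ I, a t ≠ 0 := fun t h h0 => by simpa [h0] using htl t h
  have hD : ∀ t ∈ I, a₁ t * b₁ t < 0 := fun t h => by
    have h3 : 0 < a t ^ 2 := by have := ha0 t h; positivity
    nlinarith [htl t h]
  have hode : ∀ t ∈ I, 2 * a₁ t ^ 2 * b₁ t = a t * (a₁ t * b₂ t - b₁ t * a₂ t) := fun t h => by
    have hp := mk_mem_prod h hs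
    have := hm (t, s) hp
    rw [minimalNumerator, hE t h, hF t h, hG t h, partial₁_eqOn hU h1 hp, h1 hp,
      partial₂_partial₂_revParabolic, partial₂_revParabolic, revParabolic_eq_nullFrame,
      partial₁_revParabolic (ha' t h) (hb' t h), det_nullFrame, det_nullFrame] at this
    rw [← sub_eq_zero]
    refine (mul_eq_zero.1 (Eq.trans ?_ this)).resolve_left (pow_ne_zero 2 (ha0 t h))
    simp [Matrix.det_fin_three]
    ring
  obtain ⟨t₀, ht₀⟩ := hIc.nonempty
  obtain ⟨σ, hσ, hpos⟩ := exists_sign (ha0 t₀ ht₀)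
  have hσ0 : σ ≠ 0 := fun h => by simp [h] at hσ
  have hσa : ∀ t ∈ I, 0 < σ * a t := hIc.isPreconnected.pos_of_ne_zero
    (continuousOn_const.mul haa.continuousOn) (fun t h => mul_ne_zero hσ0 (ha0 t h)) ht₀ hpos
  obtain ⟨A, d, hA, h⟩ := parabolic_profile hI hIc ha ha' hb hb' ha0 hD hode
  -- `B = 0` suffices: the cubic of the model is `((t+B)³ - B³)/6`, so `B` only shifts `t` and
  -- translates along `L₁`. The constant `d` is removed by a translation along `L₁` too. The
  -- parameter `t = -σa/A` is negative as the model requires, and `s ↦ -s` compensates its sign in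
  -- the `L₃` coordinate.
  refine ⟨A, 0, hA, congruentToPart_of_prod
    (isCongruence_smul_add hσ (nullFrame (-(σ * d)) 0 0))
    (u := fun t => -(σ * a t) / A) (v := fun s => -s) ?_ (by simpa using hJ.neg)
    (fun t ht s _ => ⟨?_, mem_univ _⟩) (fun t ht s _ => ?_)⟩
  · refine AnalyticOnNhd.isOpen_image_of_deriv_ne_zero hI
      ((analyticOnNhd_const.mul haa).neg.div analyticOnNhd_const fun _ _ => hA.ne') fun t h => ?_
    have hd : HasDerivAt (fun t => -(σ * a t) / A) (-(σ * a₁ t) / A) t :=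
      ((ha t h).const_mul σ).neg.div_const A
    rw [hd.deriv]
    refine div_ne_zero (neg_ne_zero.2 (mul_ne_zero hσ0 fun h0 => ?_)) hA.ne'
    simpa [h0] using hD t h
  · rw [mem_Iio, neg_zero]
    exact div_neg_of_neg_of_pos (neg_neg_of_pos (hσa t ht)) hA
  · have hσ3 : σ ^ 3 = σ := by rw [pow_succ, hσ, one_mul]
    rw [revParabolic_eq_nullFrame, h t ht, parabolicCatenoid]
    have hlin : ∀ x y z x', σ • nullFrame x y z + nullFrame x' 0 0 =
        nullFrame (σ * x + x') (σ * y) (σ * z) := fun x y z x' => by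
      simp only [nullFrame]
      module
    have hlin' : ∀ x y z, A • nullFrame x y z = nullFrame (A * x) (A * y) (A * z) :=
      fun x y z => by
      simp only [nullFrame]
      module
    rw [hlin, hlin']
    congr 1
    · field_simp
      linear_combination 2 * a t ^ 3 * hσ3
    · field_simp
      ring
    · field_simp
      ring

end LightlikeAxis

/-! ### The classification -/

theorem mainTheorem4 (X : ℝ × ℝ → L3) (I J : Set ℝ)
    (hrev : IsSurfaceOfRevolution X I J)
    (hanalytic : AnalyticOnNhd ℝ X (I ×ˢ J))
    (htimelike : IsTimelikeOn X (I ×ˢ J))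
    (hminimal : IsMinimalOn X (I ×ˢ J))
    (hnonplanar : ¬ IsPlanarOn X (I ×ˢ J)) :
    (∃ A θ : ℝ, 0 < A ∧
      CongruentToPart (X '' (I ×ˢ J)) (ellipticCatenoid A θ) ellipticCatenoidDomain) ∨
    (∃ A θ : ℝ, 0 < A ∧
      CongruentToPart (X '' (I ×ˢ J)) (hyperbolicCatenoid A θ) hyperbolicCatenoidDomain) ∨
    (∃ A θ : ℝ, 0 < A ∧
      CongruentToPart (X '' (I ×ˢ J)) (spacelikeProfileSurface A θ) Set.univ) ∨
    (∃ A B : ℝ, 0 < A ∧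
      CongruentToPart (X '' (I ×ˢ J)) (parabolicCatenoid A B) (parabolicCatenoidDomain B)) := by
  obtain ⟨⟨hI, hIc⟩, ⟨hJ, hJc⟩, a, b, Φ, hΦ, hX⟩ := hrev
  obtain ⟨e, c, he, hΦ⟩ := hΦ.exists_equiv
  obtain rfl : Φ = fun x => e x + c := funext hΦ
  have hU := hI.prod hJ
  have hnum := minimalNumerator_eq_zero htimelike hminimal
  rcases hX with h | h | h | h
  · left
    obtain ⟨A, θ, hA, hc⟩ := revElliptic_congruent hI hIc hJ hJc.nonempty
      (analyticOnNhd_of_congruent hU h hanalytic) (isTimelikeOn_of_congruent hU he h htimelike)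
      (minimalNumerator_eq_zero_of_congruent hU he h hnum)
    exact ⟨A, θ, hA, congruentToPart_of_congruent he h hc⟩
  · right; left
    obtain ⟨A, θ, hA, hc⟩ := revHyperbolic_congruent hI hIc hJ hJc.nonempty
      (analyticOnNhd_of_congruent hU h hanalytic) (isTimelikeOn_of_congruent hU he h htimelike)
      (minimalNumerator_eq_zero_of_congruent hU he h hnum)
      (fun hp => hnonplanar (isPlanarOn_of_congruent he h hp))
    exact ⟨A, θ, hA, congruentToPart_of_congruent he h hc⟩
  · right; right; left
    obtain ⟨A, θ, hA, hc⟩ := revSpacelikeProfile_congruent hI hIc hJ hJc.nonempty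
      (analyticOnNhd_of_congruent hU h hanalytic) (isTimelikeOn_of_congruent hU he h htimelike)
      (minimalNumerator_eq_zero_of_congruent hU he h hnum)
      (fun hp => hnonplanar (isPlanarOn_of_congruent he h hp))
    exact ⟨A, θ, hA, congruentToPart_of_congruent he h hc⟩
  · right; right; right
    obtain ⟨A, B, hA, hc⟩ := revParabolic_congruent hI hIc hJ hJc.nonempty
      (analyticOnNhd_of_congruent hU h hanalytic) (isTimelikeOn_of_congruent hU he h htimelike)
      (minimalNumerator_eq_zero_of_congruent hU he h hnum)
    exact ⟨A, B, hA, congruentToPart_of_congruent he h hc⟩
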